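/- All graphs are finite and simple. Let $G$ be a graph and let $f : 2^{V(G)} \to \mathbb{R}_{\ge 0}$ be a width function, i.e. $f(X) \le f(Y)$ whenever $X \subseteq Y \subseteq V(G)$. For a graph $H$ with $V(H) \subseteq V(G)$, the $f$-tree-width $\operatorname{tw}_f(H)$ is the minimum, over all tree decompositions $(T,(B_t)_{t\in V(T)})$ of $H$, of $\max_{t \in V(T)} f(B_t)$. For a set $X$ of vertices of a graph $H$, $N_H(X)$ denotes the set of vertices outside $X$ that have a neighbour in $X$. A set $S$ is a minimal separator of $G$ if there are non-adjacent vertices $u,v$ lying in different components of $G-S$ such that no proper subset of $S$ has this property for the same pair $u,v$. A full block of $G$ is a pair $(S,C)$ where $S$ is a minimal separator of $G$ and $C$ is (the vertex set of) a component of $G-S$ with $N_G(C)=S$. For sets $S, C$ of vertices of a graph $H$, the realization $R_H(S,C)$ is the graph obtained from $H[S\cup C]$ by turning $S$ into a clique; write $R(S,C)=R_G(S,C)$. A potential maximal clique of $G$ is an inclusion-maximal clique of some minimal triangulation of $G$, where a minimal triangulation is an edge-minimal chordal graph on $V(G)$ containing all edges of $G$; $\Pi_G$ is the set of potential maximal cliques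 of $G$. For a set $\Omega$ of vertices of a graph $H$, the blocks associated with $\Omega$ in $H$ are the pairs $(N_H(C'),C')$ where $C'$ is a component of $H-\Omega$. Lemma. Let $(S,C)$ be a full block of $G$ and $f$ a width function on $V(G)$. Then $$\operatorname{tw}_f(R(S,C)) \;=\; \min_{\substack{\Omega\in\Pi_G\\ S\subsetneq\Omega\subseteq S\cup C}} \;\max_i\,\bigl\{f(\Omega),\ \operatorname{tw}_f\bigl(R_{R(S,C)}(S_i,C_i)\bigr)\bigr\},$$ where the maximum is over $f(\Omega)$ and all blocks $(S_i,C_i)$ associated with $\Omega$ in $R(S,C)$. In particular, at least one such $\Omega$ exists and the minimum is attained. -/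

import Mathlib

open scoped NNReal

namespace MonotoneWidth

universe u

/-! ### Components, neighbourhoods, minimal separators and blocks -/

section Separators

variable {V : Type u} (G : SimpleGraph V)

/-- `C` is (the vertex set of) a connected component of `G - X`. -/
def IsComponentOff (X C : Set V) : Prop :=
  ∃ D : G.ComponentCompl X, D.supp = C

/-- The neighbourhood `N(X)` of a set of vertices: all vertices outside `X` which are adjacent to
a vertex of `X`. -/
def nbhd (X : Set V) : Set V :=
  {u | u ∉ X ∧ ∃ v ∈ X, G.Adj v u}

/-- `S` is a `u,v`-separator: `u` and `v` are non-adjacent and lie in different connected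
components of `G - S`. -/
def IsSeparatorOf (u v : V) (S : Set V) : Prop :=
  ¬ G.Adj u v ∧ ∃ (hu : u ∉ S) (hv : v ∉ S), G.componentComplMk hu ≠ G.componentComplMk hv

/-- `S` is a minimal separator: for some `u, v` it is a `u,v`-separator no proper subset of which
is a `u,v`-separator. -/
def IsMinimalSeparator (S : Set V) : Prop :=
  ∃ u v : V, Minimal (IsSeparatorOf G u v) S

/-- `(S, C)` is a block: `S` is a minimal separator and `C` is a component of `G - S`. -/
def IsBlock (S C : Set V) : Prop :=
  IsMinimalSeparator G S ∧ IsComponentOff G S C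

/-- `(S, C)` is a full block: a block with `N(C) = S`. -/
def IsFullBlock (S C : Set V) : Prop :=
  IsBlock G S C ∧ nbhd G C = S

/-- The realization `R(S, C)`: the graph with vertex set `S ∪ C` that is obtained from the induced
subgraph `G[S ∪ C]` by turning `S` into a clique. -/
def realization (S C : Set V) : SimpleGraph ↥(S ∪ C) where
  Adj x y := x ≠ y ∧ (G.Adj x.1 y.1 ∨ (x.1 ∈ S ∧ y.1 ∈ S))
  symm := ⟨fun _ _ h => ⟨h.1.symm, h.2.imp (fun a => a.symm) (fun a => a.symm)⟩⟩
  loopless := ⟨fun _ h => h.1 rfl⟩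

/-- `(S, C)` is a block associated with `Ω`: `C` is a component of `G - Ω` and `S = N(C)`. -/
def IsAssociatedBlock (Ω S C : Set V) : Prop :=
  IsComponentOff G Ω C ∧ S = nbhd G C

end Separators

/-! ### Triangulations and potential maximal cliques -/

section Triangulations

variable {V : Type u} (G : SimpleGraph V)

/-- Every cycle of length at least four has a chord. -/
def IsChordal : Prop :=
  ∀ (v : V) (c : G.Walk v v), c.IsCycle → 4 ≤ c.length →
    ∃ x ∈ c.support, ∃ y ∈ c.support, G.Adj x y ∧ s(x, y) ∉ c.edges

/-- `I` is a triangulation of `G`: a chordal graph on the same vertices containing all edges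
of `G`. -/
def IsTriangulation (I : SimpleGraph V) : Prop :=
  G ≤ I ∧ IsChordal I

/-- `I` is an (edge-)minimal triangulation of `G`. -/
def IsMinimalTriangulation (I : SimpleGraph V) : Prop :=
  Minimal (IsTriangulation G) I

/-- `Ω` is a potential maximal clique of `G`: an inclusion-maximal clique of some minimal
triangulation of `G`. -/
def IsPotentialMaximalClique (Ω : Set V) : Prop :=
  ∃ I : SimpleGraph V, IsMinimalTriangulation G I ∧ Maximal I.IsClique Ω

end Triangulations

/-! ### Tree decompositions and `f`-tree-width -/

section TreeWidth

variable {V : Type u}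

/-- A tree decomposition of the graph `G`, whose tree has the node set `ι`. -/
structure TreeDecomposition (G : SimpleGraph V) (ι : Type) where
  /-- the tree -/
  tree : SimpleGraph ι
  /-- the bags -/
  bag : ι → Set V
  isTree : tree.IsTree
  vertex_mem : ∀ v : V, ∃ t, v ∈ bag t
  edge_mem : ∀ x y : V, G.Adj x y → ∃ t, x ∈ bag t ∧ y ∈ bag t
  subtree : ∀ v : V, (tree.induce {t | v ∈ bag t}).Connected

/-- The `f`-width of a tree decomposition: the maximum of `f` over the bags. -/
noncomputable def TreeDecomposition.width {G : SimpleGraph V} {ι : Type}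
    (D : TreeDecomposition G ι) (f : Set V → ℝ≥0) : ℝ≥0 :=
  ⨆ t, f (D.bag t)

/-- The `f`-widths of all tree decompositions of `G` (with a finite tree). -/
def treeDecompositionWidths (f : Set V → ℝ≥0) (G : SimpleGraph V) : Set ℝ≥0 :=
  {w | ∃ (ι : Type) (_ : Finite ι) (D : TreeDecomposition G ι), D.width f = w}

/-- The `f`-tree-width of `G`: the minimum `f`-width of all tree decompositions of `G`. For a
finite graph this minimum is attained, see `isLeast_treeWidth`. -/
noncomputable def treeWidth (f : Set V → ℝ≥0) (G : SimpleGraph V) : ℝ≥0 :=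
  sInf (treeDecompositionWidths f G)

/-- The restriction of a set function on `V` to the subsets of `U ⊆ V`. -/
def restrict (f : Set V → ℝ≥0) (U : Set V) : Set ↥U → ℝ≥0 :=
  fun X => f (Subtype.val '' X)

/-- On a finite graph, the minimum in the definition of the `f`-tree-width exists. -/
theorem isLeast_treeWidth [Finite V] (f : Set V → ℝ≥0) (G : SimpleGraph V) :
    IsLeast (treeDecompositionWidths f G) (treeWidth f G) := by
  have hne : (treeDecompositionWidths f G).Nonempty := by
    refine ⟨_, Unit, inferInstance, ⟨⊥, fun _ => Set.univ, .of_subsingleton, ?_, ?_, ?_⟩, rfl⟩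
    · exact fun v => ⟨(), trivial⟩
    · exact fun x y _ => ⟨(), trivial, trivial⟩
    · intro v
      have : Nonempty {t : Unit | v ∈ (Set.univ : Set V)} := ⟨⟨(), trivial⟩⟩
      exact ⟨.of_subsingleton⟩
  have hfin : (treeDecompositionWidths f G).Finite := by
    refine (Set.finite_range f).subset ?_
    rintro w ⟨ι, _, D, rfl⟩
    have : Nonempty ι := D.isTree.connected.nonempty
    obtain ⟨t, ht⟩ := exists_eq_ciSup_of_finite (f := fun t => f (D.bag t))
    exact ⟨D.bag t, ht⟩
  exact ⟨hne.csInf_mem hfin, fun w hw => csInf_le (OrderBot.bddBelow _) hw⟩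

/-- The value `max_i {f(Ω), tw_f(R(S_i, C_i))}`, where `(S_i, C_i)` runs over the blocks associated
with `Ω` in `R(S, C)`. The sets `S_i`, `C_i` live in the vertex set `S ∪ C` of `R(S, C)`, the width
function is restricted accordingly, and `Ω ⊆ S ∪ C` is read as a set of vertices of `R(S, C)`.
The set whose maximum is taken contains `f(Ω)` and is finite for finite graphs. -/
noncomputable def cliqueValue (G : SimpleGraph V) (f : Set V → ℝ≥0) (S C Ω : Set V) : ℝ≥0 :=
  sSup ({f Ω} ∪ {w | ∃ S' C' : Set ↥(S ∪ C),
    IsAssociatedBlock (realization G S C) (Subtype.val ⁻¹' Ω) S' C' ∧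
    w = treeWidth (restrict (restrict f (S ∪ C)) (S' ∪ C'))
      (realization (realization G S C) S' C')})

end TreeWidth

end MonotoneWidth

/-!
Write `R` for `R(S, C)`.

**Every `Ω` gives an upper bound for `tw_f(R)`.** This holds for all sets `Ω` of vertices: take
tree decompositions of the realizations of the blocks associated with `Ω` in `R`. Each of them has a
bag containing the clique `N(C')` (Helly property), and joining that node by an edge to a new node
with bag `Ω` produces a tree decomposition of `R` (`treeWidth_le_of_associatedBlocks`).

**Some potential maximal clique attains `tw_f(R)`.** Let `D` be an optimal tree decomposition of
`R`. Turn its bags and the set `V \ C` into cliques. The resulting graph `bagFill D` is chordal,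
since it has simplicial vertices everywhere (`isChordal_bagFill`), and contains `G`; let `J` be a
minimal triangulation of `G` below it. The two facts on `J` that matter are:

* `S` is a clique of `J`. Indeed `G - S` has a second component that is adjacent to all of `S`, and
  `J` has no edge between it and `C`, so two non-adjacent vertices of `S` would lie on an induced
  cycle through the two components (`IsChordal.adj_of_isConnectedOn`).
* Some `c ∈ C` is adjacent in `J` to all of `S` (`IsChordal.exists_adj_forall`).

A maximal clique `Ω` of `J` containing `S` and `c` is a potential maximal clique of `G` inside
`S ∪ C`. Any two of its vertices share a bag of `D`, hence `Ω` lies in one bag and `f(Ω) ≤ tw_f(R)`.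
The neighbourhoods of the components of `R - Ω` are contained in `Ω`, so the traces of the bags of
`D` decompose the realizations of the associated blocks (`treeWidth_realization_le`).

Chordality of `bagFill D` and the Helly property both come from `exists_mem_bag_forall_mem`, a
statement on families of subtrees proved by removing leaves.
-/

namespace MonotoneWidth

/-! ### Connected vertex sets -/

/-- `s` induces a connected (or empty) subgraph of `G`, in the form of a cut condition: a nonempty
part of `s` that no edge of `G` leaves inside `s` is all of `s`. -/
def IsConnectedOn {V : Type*} (G : SimpleGraph V) (s : Set V) : Prop :=
  ∀ Q ⊆ s, Q.Nonempty → (∀ a ∈ Q, ∀ b ∈ s, G.Adj a b → b ∈ Q) → s ⊆ Q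

section ConnectedOn

variable {V : Type*} {G G' : SimpleGraph V} {s : Set V}

theorem isConnectedOn_iff_preconnected : IsConnectedOn G s ↔ (G.induce s).Preconnected := by
  constructor
  · intro h x y
    let Q : Set V := {z | ∃ hz : z ∈ s, (G.induce s).Reachable x ⟨z, hz⟩}
    have hQ : s ⊆ Q := by
      refine h Q (fun z hz => hz.1) ⟨x, x.2, .refl _⟩ ?_
      rintro a ⟨ha, hxa⟩ b hb hab
      exact ⟨hb, hxa.trans (SimpleGraph.Adj.reachable (by exact hab))⟩
    exact (hQ y.2).2
  · rintro h Q hQs ⟨q, hq⟩ hcl y hy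
    by_contra hyQ
    obtain ⟨p⟩ := h ⟨q, hQs hq⟩ ⟨y, hy⟩
    obtain ⟨d, -, h1, h2⟩ := p.exists_boundary_dart (Subtype.val ⁻¹' Q) hq hyQ
    exact h2 (hcl _ h1 _ d.snd.2 d.adj)

theorem IsConnectedOn.mono (h : IsConnectedOn G s) (hG : G ≤ G') : IsConnectedOn G' s :=
  fun Q hQ hne hcl => h Q hQ hne fun a ha b hb hab => hcl a ha b hb (hG hab)

theorem isConnectedOn_singleton (a : V) : IsConnectedOn G {a} := by
  rintro Q hQ ⟨q, hq⟩ - x rfl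
  obtain rfl := hQ hq
  exact hq

theorem IsConnectedOn.union {t : Set V} (hs : IsConnectedOn G s) (ht : IsConnectedOn G t)
    {a b : V} (ha : a ∈ s) (hb : b ∈ t) (hab : G.Adj a b) : IsConnectedOn G (s ∪ t) := by
  rintro Q hQ ⟨q, hq⟩ hcl
  have hsQ : (Q ∩ s).Nonempty → s ⊆ Q := fun hne =>
    (hs _ Set.inter_subset_right hne fun x hx y hy hxy =>
      ⟨hcl x hx.1 y (.inl hy) hxy, hy⟩).trans Set.inter_subset_left
  have htQ : (Q ∩ t).Nonempty → t ⊆ Q := fun hne =>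
    (ht _ Set.inter_subset_right hne fun x hx y hy hxy =>
      ⟨hcl x hx.1 y (.inr hy) hxy, hy⟩).trans Set.inter_subset_left
  rcases hQ hq with h | h
  · have h1 := hsQ ⟨q, hq, h⟩
    exact Set.union_subset h1 (htQ ⟨b, hcl a (h1 ha) b (.inr hb) hab, hb⟩)
  · have h1 := htQ ⟨q, hq, h⟩
    exact Set.union_subset (hsQ ⟨a, hcl b (h1 hb) a (.inl ha) hab.symm, ha⟩) h1

theorem IsConnectedOn.insert {a b : V} (hs : IsConnectedOn G s) (hb : b ∈ s) (hab : G.Adj a b) :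
    IsConnectedOn G (insert a s) :=
  (isConnectedOn_singleton a).union hs rfl hb hab

/-- Every vertex of `s` lies in a connected component of the subgraph induced by `s`. -/
theorem exists_isConnectedOn_component {c : V} (hc : c ∈ s) :
    ∃ P ⊆ s, c ∈ P ∧ IsConnectedOn G P ∧ ∀ a ∈ P, ∀ b ∈ s, G.Adj a b → b ∈ P := by
  let P : Set V := {x | x ∈ s ∧
    ∀ Q ⊆ s, c ∈ Q → (∀ a ∈ Q, ∀ b ∈ s, G.Adj a b → b ∈ Q) → x ∈ Q}
  have hcP : c ∈ P := ⟨hc, fun _ _ h _ => h⟩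
  have hcl : ∀ a ∈ P, ∀ b ∈ s, G.Adj a b → b ∈ P := fun a ha b hb hab =>
    ⟨hb, fun Q hQ hcQ hQcl => hQcl a (ha.2 Q hQ hcQ hQcl) b hb hab⟩
  refine ⟨P, fun x hx => hx.1, hcP, ?_, hcl⟩
  rintro Q hQ ⟨q, hq⟩ hQcl x hx
  by_cases hcQ : c ∈ Q
  · exact hx.2 Q (fun y hy => (hQ hy).1) hcQ fun a ha b hb hab =>
      hQcl a ha b (hcl a (hQ ha) b hb hab) hab
  · -- Otherwise `P \ Q` is closed as well, and contains `c`, which leaves nothing for `Q`.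
    refine absurd hq ((hQ hq).2 (P \ Q) (fun y hy => hy.1.1) ⟨hcP, hcQ⟩ ?_).2
    exact fun a ha b hb hab => ⟨hcl a ha.1 b hb hab, fun hbQ => ha.2 (hQcl b hbQ a ha.1 hab.symm)⟩

end ConnectedOn

/-! ### Families of subtrees of a tree -/

section Subtrees

variable {ι V : Type*} {T : SimpleGraph ι}

theorem exists_leaf_of_isAcyclic (hT : T.IsAcyclic) (N : Finset ι) (hN : N.Nonempty) :
    ∃ l ∈ N, ∀ a ∈ N, ∀ b ∈ N, T.Adj l a → T.Adj l b → a = b := by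
  have : Nonempty (N : Set ι) := hN.to_subtype
  have hac := hT.induce (N : Set ι)
  obtain ⟨u, v, p, hp, hmax⟩ :=
    SimpleGraph.Walk.exists_isPath_forall_isPath_length_le_length (T.induce (N : Set ι))
  have key : ∀ w, (T.induce (N : Set ι)).Adj u w → w = p.snd := by
    intro w hw
    apply hac.eq_snd_of_adj_start hp hw
    by_contra hwp
    have h1 := hmax _ _ (p.cons hw.symm) (hp.cons hwp)
    simp at h1
  refine ⟨u, u.2, fun a ha b hb hua hub => ?_⟩
  have h1 := key ⟨a, ha⟩ hua
  have h2 := key ⟨b, hb⟩ hub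
  exact congrArg Subtype.val (h1.trans h2.symm)

/-- For vertices represented by subtrees of a tree, any nonempty set `A` of vertices has a member
`v` with a node `t` such that every member of `A` that meets `v` somewhere also meets it at `t`.
This yields both the chordality of the intersection graph and the Helly property. The proof removes
a leaf of the tree: either some `v` lives on that leaf only, or the leaf is dispensable. -/
theorem exists_mem_bag_forall_mem (hT : T.IsAcyclic) (bag : ι → Set V) (N : Finset ι) (A : Set V)
    (hA : A.Nonempty) (hcov : ∀ v ∈ A, ∃ t ∈ N, v ∈ bag t)
    (hconn : ∀ v ∈ A, IsConnectedOn T {t | t ∈ N ∧ v ∈ bag t}) :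
    ∃ v ∈ A, ∃ t ∈ N, v ∈ bag t ∧ ∀ w ∈ A, (∃ t' ∈ N, v ∈ bag t' ∧ w ∈ bag t') → w ∈ bag t := by
  classical
  induction N using Finset.strongInduction with
  | H N ih =>
    obtain ⟨v₀, hv₀⟩ := hA
    obtain ⟨t₀, ht₀, -⟩ := hcov v₀ hv₀
    obtain ⟨l, hl, huniq⟩ := exists_leaf_of_isAcyclic hT N ⟨t₀, ht₀⟩
    by_cases hex : ∃ v ∈ A, v ∈ bag l ∧ ∀ p ∈ N, T.Adj l p → v ∉ bag p
    · obtain ⟨v, hvA, hvl, hv⟩ := hex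
      have hsub := hconn v hvA {l} (by rintro _ rfl; exact ⟨hl, hvl⟩) ⟨l, rfl⟩ (by
        rintro _ rfl b ⟨hbN, hb⟩ hadj
        exact absurd hb (hv b hbN hadj))
      refine ⟨v, hvA, l, hl, hvl, ?_⟩
      rintro w - ⟨t', ht', hvt', hwt'⟩
      obtain rfl : t' = l := hsub ⟨ht', hvt'⟩
      exact hwt'
    · push Not at hex
      have hcov' : ∀ v ∈ A, ∃ t ∈ N.erase l, v ∈ bag t := by
        intro v hv
        obtain ⟨t, ht, hvt⟩ := hcov v hv
        by_cases htl : t = l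
        · subst htl
          obtain ⟨p, hp, hlp, hvp⟩ := hex v hv hvt
          exact ⟨p, Finset.mem_erase.2 ⟨hlp.ne', hp⟩, hvp⟩
        · exact ⟨t, Finset.mem_erase.2 ⟨htl, ht⟩, hvt⟩
      have hconn' : ∀ v ∈ A, IsConnectedOn T {t | t ∈ N.erase l ∧ v ∈ bag t} := by
        rintro v hv Q hQ hQne hcl t ⟨htN, hvt⟩
        obtain ⟨htl, htN⟩ := Finset.mem_erase.1 htN
        have hQ' : ∀ q ∈ Q, q ≠ l ∧ q ∈ N ∧ v ∈ bag q := fun q hq =>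
          ⟨(Finset.mem_erase.1 (hQ hq).1).1, (Finset.mem_erase.1 (hQ hq).1).2, (hQ hq).2⟩
        by_cases hlQ : v ∈ bag l ∧ ∃ q ∈ Q, T.Adj l q
        · obtain ⟨hvl, p, hpQ, hlp⟩ := hlQ
          have h := hconn v hv (insert l Q) ?_ ⟨l, .inl rfl⟩ ?_ ⟨htN, hvt⟩
          · exact h.resolve_left htl
          · rintro q (rfl | hq)
            · exact ⟨hl, hvl⟩
            · exact (hQ' q hq).2
          · rintro a (rfl | ha) b ⟨hbN, hvb⟩ hab
            · exact .inr (huniq b hbN p (hQ' p hpQ).2.1 hab hlp ▸ hpQ)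
            · by_cases hbl : b = l
              · exact .inl hbl
              · exact .inr (hcl a ha b ⟨Finset.mem_erase.2 ⟨hbl, hbN⟩, hvb⟩ hab)
        · refine hconn v hv Q (fun q hq => (hQ' q hq).2) hQne ?_ ⟨htN, hvt⟩
          rintro a ha b ⟨hbN, hvb⟩ hab
          by_cases hbl : b = l
          · subst hbl
            exact absurd ⟨hvb, a, ha, hab.symm⟩ hlQ
          · exact hcl a ha b ⟨Finset.mem_erase.2 ⟨hbl, hbN⟩, hvb⟩ hab
      obtain ⟨v, hvA, t, ht, hvt, h⟩ := ih _ (Finset.erase_ssubset hl) hcov' hconn'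
      refine ⟨v, hvA, t, Finset.mem_of_mem_erase ht, hvt, ?_⟩
      rintro w hw ⟨t', ht', hvt', hwt'⟩
      apply h w hw
      by_cases htl : t' = l
      · subst htl
        obtain ⟨p, hp, hlp, hvp⟩ := hex v hvA hvt'
        obtain ⟨q, hq, hlq, hwq⟩ := hex w hw hwt'
        obtain rfl := huniq p hp q hq hlp hlq
        exact ⟨p, Finset.mem_erase.2 ⟨hlp.ne', hp⟩, hvp, hwq⟩
      · exact ⟨t', Finset.mem_erase.2 ⟨htl, ht'⟩, hvt', hwt'⟩

end Subtrees

section TreeDecompositionBags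

variable {V : Type*} {G : SimpleGraph V} {ι : Type}

theorem TreeDecomposition.isConnectedOn (D : TreeDecomposition G ι) (v : V) :
    IsConnectedOn D.tree {t | v ∈ D.bag t} :=
  isConnectedOn_iff_preconnected.2 (D.subtree v).preconnected

theorem TreeDecomposition.exists_mem_bag_forall_mem [Finite ι] (D : TreeDecomposition G ι) {A : Set V}
    (hA : A.Nonempty) :
    ∃ v ∈ A, ∃ t, ∀ w ∈ A, (∃ t', v ∈ D.bag t' ∧ w ∈ D.bag t') → w ∈ D.bag t := by
  have := Fintype.ofFinite ι
  obtain ⟨v, hv, t, -, -, h⟩ := MonotoneWidth.exists_mem_bag_forall_mem D.isTree.isAcyclic D.bag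
    Finset.univ A hA (fun v _ => by simpa using D.vertex_mem v)
    (fun v _ => by simpa using D.isConnectedOn v)
  exact ⟨v, hv, t, fun w hw ⟨t', h'⟩ => h w hw ⟨t', Finset.mem_univ _, h'⟩⟩

/-- The Helly property: vertices that pairwise share a bag all share one. -/
theorem TreeDecomposition.exists_subset_bag [Finite ι] (D : TreeDecomposition G ι) {A : Set V}
    (hA : ∀ x ∈ A, ∀ y ∈ A, x ≠ y → ∃ t, x ∈ D.bag t ∧ y ∈ D.bag t) : ∃ t, A ⊆ D.bag t := by
  rcases A.eq_empty_or_nonempty with rfl | hne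
  · obtain ⟨t⟩ := D.isTree.connected.nonempty
    exact ⟨t, Set.empty_subset _⟩
  · obtain ⟨v, hv, t, h⟩ := D.exists_mem_bag_forall_mem hne
    refine ⟨t, fun w hw => h w hw ?_⟩
    by_cases hvw : v = w
    · subst hvw
      simpa using D.vertex_mem v
    · exact hA v hv w hw hvw

end TreeDecompositionBags

/-! ### Chordal graphs -/

section Chordal

variable {V : Type*} {G : SimpleGraph V}

/-- A graph is chordal if each of its nonempty induced subgraphs has a simplicial vertex. -/
theorem isChordal_of_exists_simplicial
    (h : ∀ A : Set V, A.Nonempty →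
      ∃ v ∈ A, ∀ a ∈ A, ∀ b ∈ A, G.Adj v a → G.Adj v b → a ≠ b → G.Adj a b) :
    IsChordal G := by
  classical
  intro u c hc hlen
  obtain ⟨v, hv, hsimp⟩ := h {x | x ∈ c.support} ⟨u, c.start_mem_support⟩
  have hd : (c.rotate v hv).IsCycle := hc.rotate hv
  have hdl : (c.rotate v hv).length = c.length := c.length_rotate v hv
  have hsup : ∀ x, x ∈ (c.rotate v hv).support → x ∈ c.support := fun x hx =>
    (c.mem_support_rotate_iff v hv).1 hx
  have hed : ∀ e, e ∈ c.edges → e ∈ (c.rotate v hv).edges := fun e he =>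
    (c.rotate_edges v hv).mem_iff.2 he
  generalize c.rotate v hv = d at hd hdl hsup hed
  have hnil : ¬ d.Nil := hd.not_nil
  refine ⟨d.snd, hsup _ (d.getVert_mem_support _), d.penultimate,
    hsup _ (d.getVert_mem_support _), ?_, fun he => ?_⟩
  · exact hsimp _ (hsup _ (d.getVert_mem_support _)) _ (hsup _ (d.getVert_mem_support _))
      (d.adj_snd hnil) (d.adj_penultimate hnil).symm hd.snd_ne_penultimate
  · -- On a cycle of length at least four, the two neighbours of `v` are not consecutive.
    obtain ⟨i, hi, hie⟩ := (d.mk_mem_edges_iff_exists).1 (hed _ he)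
    have hinj := hd.getVert_injOn
    have hinj' := hd.getVert_injOn'
    have hs : d.snd = d.getVert 1 := rfl
    have hp : d.penultimate = d.getVert (d.length - 1) := rfl
    rw [hs, hp, Sym2.eq_iff] at hie
    rcases hie with ⟨h1, h2⟩ | ⟨h1, h2⟩
    · have e1 := hinj' (by simp; omega) (by simp; omega) h1
      have e2 := hinj (by simp; omega) (by simp; omega) h2
      omega
    · have e1 := hinj' (by simp; omega) (by simp) h1
      have e2 := hinj (by simp; omega) (by simp; omega) h2
      omega

/-- Two vertices attached to a connected set are joined by an induced path through it. -/
theorem exists_induced_path {a b : V} {P : Set V} (hP : IsConnectedOn G P)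
    (ha : ∃ p ∈ P, G.Adj a p) (hb : ∃ p ∈ P, G.Adj b p) :
    ∃ w : G.Walk a b, w.IsPath ∧ (∀ x ∈ w.support, x = a ∨ x = b ∨ x ∈ P) ∧
      ∀ x ∈ w.support, ∀ y ∈ w.support, G.Adj x y → s(x, y) ∈ w.edges := by
  obtain ⟨p, hp, hap⟩ := ha
  obtain ⟨q, hq, hbq⟩ := hb
  have hcon := isConnectedOn_iff_preconnected.1
    ((hP.insert hq hbq).insert (Set.mem_insert_of_mem b hp) hap)
  obtain ⟨w, hw, hlen⟩ := (hcon ⟨a, Set.mem_insert _ _⟩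
    ⟨b, Set.mem_insert_of_mem a (Set.mem_insert _ _)⟩).exists_path_of_dist
  have hle : ∀ i j, i < j → j ≤ w.length →
      (G.induce (insert a (insert b P))).Adj (w.getVert i) (w.getVert j) → j = i + 1 := by
    intro i j hij hj hadj
    have h1 := SimpleGraph.dist_le ((w.take i).append (SimpleGraph.Walk.cons hadj (w.drop j)))
    rw [← hlen] at h1
    simp only [SimpleGraph.Walk.length_append, SimpleGraph.Walk.length_cons,
      SimpleGraph.Walk.take_length, SimpleGraph.Walk.drop_length] at h1
    omega
  let φ := SimpleGraph.Embedding.induce (G := G) (insert a (insert b P))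
  have hsupp : ∀ x ∈ (w.map φ.toHom).support, ∃ y ∈ w.support, y.1 = x := by
    intro x hx
    rw [SimpleGraph.Walk.support_map, List.mem_map] at hx
    exact hx
  have hedge : ∀ e ∈ w.edges, e.map Subtype.val ∈ (w.map φ.toHom).edges := by
    intro e he
    rw [SimpleGraph.Walk.edges_map]
    exact List.mem_map_of_mem he
  refine ⟨w.map φ.toHom, hw.map φ.injective, ?_, ?_⟩
  · intro x hx
    obtain ⟨y, -, rfl⟩ := hsupp x hx
    exact y.2
  · intro x hx y hy hxy
    obtain ⟨x, hxw, rfl⟩ := hsupp x hx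
    obtain ⟨y, hyw, rfl⟩ := hsupp y hy
    refine hedge s(x, y) ?_
    obtain ⟨i, rfl, hi⟩ := SimpleGraph.Walk.mem_support_iff_exists_getVert.1 hxw
    obtain ⟨j, rfl, hj⟩ := SimpleGraph.Walk.mem_support_iff_exists_getVert.1 hyw
    have hxy' : (G.induce (insert a (insert b P))).Adj (w.getVert i) (w.getVert j) := hxy
    rw [SimpleGraph.Walk.mk_mem_edges_iff_exists]
    rcases lt_trichotomy i j with h | rfl | h
    · obtain rfl := hle i j h hj hxy'
      exact ⟨i, by omega, rfl⟩
    · exact absurd rfl hxy'.ne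
    · obtain rfl := hle j i h hi hxy'.symm
      exact ⟨j, by omega, Sym2.eq_swap⟩

/-- In a chordal graph, two vertices with neighbours in each of two connected sets that are
neither overlapping nor joined by an edge are adjacent: otherwise induced paths through the two
sets would form an induced cycle of length at least four. -/
theorem IsChordal.adj_of_isConnectedOn (hG : IsChordal G) {a b : V} {P Q : Set V} (hab : a ≠ b)
    (hP : IsConnectedOn G P) (hQ : IsConnectedOn G Q)
    (hPQ : ∀ p ∈ P, ∀ q ∈ Q, p ≠ q ∧ ¬ G.Adj p q)
    (haP' : ∃ p ∈ P, G.Adj a p) (hbP' : ∃ p ∈ P, G.Adj b p)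
    (haQ' : ∃ q ∈ Q, G.Adj a q) (hbQ' : ∃ q ∈ Q, G.Adj b q) : G.Adj a b := by
  by_contra hnadj
  obtain ⟨w, hw, hwP, hwind⟩ := exists_induced_path hP haP' hbP'
  obtain ⟨z, hz, hzQ, hzind⟩ := exists_induced_path hQ haQ' hbQ'
  have hlen : ∀ r : G.Walk a b, 2 ≤ r.length := by
    intro r
    by_contra hr
    interval_cases h : r.length
    · exact hab (SimpleGraph.Walk.eq_of_length_eq_zero h)
    · exact hnadj (SimpleGraph.Walk.adj_of_length_eq_one h)
  have hwnd := hw.support_nodup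
  have hznd := hz.reverse.support_nodup
  rw [← SimpleGraph.Walk.cons_tail_support, List.nodup_cons] at hwnd hznd
  have hdisj : w.support.tail.Disjoint z.reverse.support.tail := by
    intro x hx hx'
    have h1 := hwP x (List.mem_of_mem_tail hx)
    have h2 := hzQ x (by simpa using List.mem_of_mem_tail hx')
    have hxa : x ≠ a := by rintro rfl; exact hwnd.1 hx
    have hxb : x ≠ b := by rintro rfl; exact hznd.1 hx'
    exact (hPQ x ((h1.resolve_left hxa).resolve_left hxb) x
      ((h2.resolve_left hxa).resolve_left hxb)).1 rfl
  have hcyc := hw.isCycle_append hz.reverse hdisj (.inl (hlen w))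
  obtain ⟨x, hx, y, hy, hxy, hne⟩ := hG a _ hcyc (by
    have h1 := hlen w
    have h2 := hlen z
    simp only [SimpleGraph.Walk.length_append, SimpleGraph.Walk.length_reverse]
    omega)
  simp only [SimpleGraph.Walk.mem_support_append_iff, SimpleGraph.Walk.support_reverse,
    List.mem_reverse] at hx hy
  simp only [SimpleGraph.Walk.edges_append, SimpleGraph.Walk.edges_reverse, List.mem_append,
    List.mem_reverse, not_or] at hne
  have hmix : ∀ x ∈ w.support, ∀ y ∈ z.support, G.Adj x y →
      s(x, y) ∈ w.edges ∨ s(x, y) ∈ z.edges := by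
    intro x hx y hy hxy
    rcases hzQ y hy with rfl | rfl | hyQ
    · exact .inl (hwind x hx _ w.start_mem_support hxy)
    · exact .inl (hwind x hx _ w.end_mem_support hxy)
    · rcases hwP x hx with rfl | rfl | hxP
      · exact .inr (hzind _ z.start_mem_support y hy hxy)
      · exact .inr (hzind _ z.end_mem_support y hy hxy)
      · exact absurd hxy (hPQ x hxP y hyQ).2
  rcases hx with hx | hx <;> rcases hy with hy | hy
  · exact hne.1 (hwind x hx y hy hxy)
  · exact (hmix x hx y hy hxy).elim hne.1 hne.2
  · rw [Sym2.eq_swap] at hne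
    exact (hmix y hy x hx hxy.symm).elim hne.1 hne.2
  · exact hne.2 (hzind x hx y hy hxy)

/-- In a chordal graph, if every vertex of a clique `S` has a neighbour in the connected set `C`,
then some vertex of `C` is adjacent to all of `S`. -/
theorem IsChordal.exists_adj_forall [Finite V] (hG : IsChordal G) {S C : Set V}
    (hC : IsConnectedOn G C) (hCne : C.Nonempty) (hS : G.IsClique S) (hdisj : ∀ s ∈ S, s ∉ C)
    (hSC : ∀ s ∈ S, ∃ c ∈ C, G.Adj s c) : ∃ c ∈ C, ∀ s ∈ S, G.Adj c s := by
  obtain ⟨c, hc, hmax⟩ := Set.exists_max_image C (fun c => {s | s ∈ S ∧ G.Adj c s}.ncard)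
    C.toFinite hCne
  refine ⟨c, hc, fun s₀ hs₀ => ?_⟩
  by_contra hcs₀
  -- A walk through `C` from `c` leads to a first neighbour `y` of `s₀`; it has at least the
  -- neighbours of `c` in `S`, in contradiction to the choice of `c`.
  obtain ⟨P, hPD, hcP, hP, hPcl⟩ := exists_isConnectedOn_component (G := G)
    (s := {x | x ∈ C ∧ ¬ G.Adj x s₀}) ⟨hc, hcs₀⟩
  have hy : ∃ p ∈ P, ∃ y ∈ C, G.Adj p y ∧ y ∉ P := by
    by_contra! hcon
    obtain ⟨z, hz, hs₀z⟩ := hSC s₀ hs₀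
    exact (hPD (hC P (fun x hx => (hPD hx).1) ⟨c, hcP⟩ (fun a ha b hb hab => hcon a ha b hb hab)
      hz)).2 hs₀z.symm
  obtain ⟨p, hp, y, hyC, hpy, hyP⟩ := hy
  have hys₀ : G.Adj y s₀ := by
    by_contra hcon
    exact hyP (hPcl p hp y ⟨hyC, hcon⟩ hpy)
  have hsub : {s | s ∈ S ∧ G.Adj c s} ⊂ {s | s ∈ S ∧ G.Adj y s} := by
    refine ⟨?_, fun h => hcs₀ (h ⟨hs₀, hys₀⟩).2⟩
    rintro s ⟨hs, hcs⟩
    have hss₀ : s ≠ s₀ := by rintro rfl; exact hcs₀ hcs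
    refine ⟨hs, (hG.adj_of_isConnectedOn (P := P) (Q := {s₀}) ?_ hP (isConnectedOn_singleton s₀)
      ?_ ⟨c, hcP, hcs.symm⟩ ⟨p, hp, hpy.symm⟩
      ⟨s₀, rfl, hS hs hs₀ hss₀⟩ ⟨s₀, rfl, hys₀⟩).symm⟩
    · rintro rfl; exact hdisj _ hs hyC
    · rintro x hx _ rfl
      exact ⟨by rintro rfl; exact hdisj _ hs₀ (hPD hx).1, (hPD hx).2⟩
  exact absurd (hmax y hyC) (not_le.2 (Set.ncard_lt_ncard hsub (Set.toFinite _)))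

end Chordal

/-! ### Gluing and restricting tree decompositions -/

section Glue

variable {ι κ : Type} {T : SimpleGraph ι} {U : SimpleGraph κ}

theorem isTree_sum_sup_edge [Finite ι] [Finite κ] (hT : T.IsTree) (hU : U.IsTree)
    (a : ι) (b : κ) :
    ((T ⊕g U) ⊔ SimpleGraph.edge (Sum.inl a) (Sum.inr b)).IsTree := by
  have h1 := (SimpleGraph.isTree_iff_connected_and_card.1 hT).2
  have h2 := (SimpleGraph.isTree_iff_connected_and_card.1 hU).2
  rw [SimpleGraph.isTree_iff_connected_and_card]
  refine ⟨hT.connected.sum_sup_edge hU.connected, ?_⟩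
  have hdisj : Disjoint (T ⊕g U).edgeSet {s(Sum.inl a, Sum.inr b)} := by
    rw [Set.disjoint_singleton_right, SimpleGraph.mem_edgeSet]
    exact SimpleGraph.not_adj_sum_inl_inr a b
  have hedge : (SimpleGraph.edge (Sum.inl a) (Sum.inr b) : SimpleGraph (ι ⊕ κ)).edgeSet =
      {s(Sum.inl a, Sum.inr b)} := by
    rw [SimpleGraph.edgeSet_edge]
    simp
  have hcard : Nat.card (T ⊕g U).edgeSet = Nat.card T.edgeSet + Nat.card U.edgeSet := by
    rw [Nat.card_congr SimpleGraph.edgeSetSumEquiv, Nat.card_sum]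
  rw [SimpleGraph.edgeSet_sup, hedge, Nat.card_coe_set_eq,
    Set.ncard_union_eq hdisj (Set.toFinite _) (Set.toFinite _), ← Nat.card_coe_set_eq, hcard,
    Set.ncard_singleton, Nat.card_sum]
  omega

theorem IsConnectedOn.image {ι κ : Type*} {T : SimpleGraph ι} {U : SimpleGraph κ} {s : Set ι}
    (hs : IsConnectedOn T s) (φ : T →g U) : IsConnectedOn U (φ '' s) := by
  rintro Q hQ ⟨q, hq⟩ hcl
  obtain ⟨x, hx, rfl⟩ := hQ hq
  have h := hs (φ ⁻¹' Q ∩ s) Set.inter_subset_right ⟨x, hq, hx⟩ fun a ha b hb hab =>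
    ⟨hcl _ ha.1 _ ⟨b, hb, rfl⟩ (φ.map_adj hab), hb⟩
  rintro _ ⟨y, hy, rfl⟩
  exact (h hy).1

theorem isConnectedOn_sum_sup_edge {W : Type*} {bag : ι → Set W} {bag' : κ → Set W} {a : ι} {b : κ}
    {v : W} (h : IsConnectedOn T {t | v ∈ bag t}) (h' : IsConnectedOn U {t | v ∈ bag' t})
    (hshare : ∀ t u, v ∈ bag t → v ∈ bag' u → v ∈ bag a ∧ v ∈ bag' b) :
    IsConnectedOn ((T ⊕g U) ⊔ SimpleGraph.edge (Sum.inl a) (Sum.inr b))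
      {t | v ∈ Sum.elim bag bag' t} := by
  have h1 := (h.image SimpleGraph.Embedding.sumInl.toHom).mono
    (le_sup_left : (T ⊕g U) ≤ (T ⊕g U) ⊔ SimpleGraph.edge (Sum.inl a) (Sum.inr b))
  have h2 := (h'.image SimpleGraph.Embedding.sumInr.toHom).mono
    (le_sup_left : (T ⊕g U) ≤ (T ⊕g U) ⊔ SimpleGraph.edge (Sum.inl a) (Sum.inr b))
  have heq : {t | v ∈ Sum.elim bag bag' t} = Sum.inl '' {t | v ∈ bag t} ∪
      Sum.inr '' {t | v ∈ bag' t} := by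
    ext (t | t) <;> simp
  rw [heq]
  by_cases hex : (∃ t, v ∈ bag t) ∧ ∃ u, v ∈ bag' u
  · obtain ⟨⟨t, ht⟩, u, hu⟩ := hex
    obtain ⟨ha, hb⟩ := hshare t u ht hu
    refine h1.union h2 (a := Sum.inl a) (b := Sum.inr b) ⟨a, ha, rfl⟩ ⟨b, hb, rfl⟩ ?_
    simp [SimpleGraph.edge]
  · rw [not_and_or] at hex
    rcases hex with hex | hex
    · have h0 : {t | v ∈ bag t} = ∅ := Set.eq_empty_iff_forall_notMem.2 fun t ht => hex ⟨t, ht⟩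
      rw [h0, Set.image_empty, Set.empty_union]
      exact h2
    · have h0 : {t | v ∈ bag' t} = ∅ := Set.eq_empty_iff_forall_notMem.2 fun t ht => hex ⟨t, ht⟩
      rw [h0, Set.image_empty, Set.union_empty]
      exact h1

end Glue

section Width

variable {W : Type*} (H : SimpleGraph W)

theorem TreeDecomposition.le_width {H : SimpleGraph W} {ι : Type} [Finite ι]
    (D : TreeDecomposition H ι) (f : Set W → ℝ≥0) (t : ι) : f (D.bag t) ≤ D.width f :=
  le_ciSup (f := fun t => f (D.bag t)) (Set.finite_range _).bddAbove t

theorem exists_treeDecomposition [Finite W] (f : Set W → ℝ≥0) :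
    ∃ (ι : Type) (_ : Finite ι) (D : TreeDecomposition H ι), ∀ t, f (D.bag t) ≤ treeWidth f H := by
  obtain ⟨ι, hι, D, hD⟩ := (isLeast_treeWidth f H).1
  exact ⟨ι, hι, D, fun t => hD ▸ D.le_width f t⟩

theorem treeWidth_le_of_forall_bag_le [Finite W] {H : SimpleGraph W} {ι : Type} [Finite ι]
    (D : TreeDecomposition H ι) {f : Set W → ℝ≥0} {w : ℝ≥0} (h : ∀ t, f (D.bag t) ≤ w) :
    treeWidth f H ≤ w := by
  have : Nonempty ι := D.isTree.connected.nonempty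
  exact ((isLeast_treeWidth f H).2 ⟨ι, inferInstance, D, rfl⟩).trans (ciSup_le h)

theorem monotone_restrict {V : Type*} {f : Set V → ℝ≥0} (hf : Monotone f) (U : Set V) :
    Monotone (restrict f U) :=
  fun _ _ h => hf (Set.image_mono h)

variable {H}

/-- Replacing the bags of a tree decomposition by their traces on `S ∪ C` decomposes the
realization, provided that the clique added on `S` is covered by the bags. -/
theorem treeWidth_realization_le [Finite W] {f : Set W → ℝ≥0} (hf : Monotone f) {ι : Type} [Finite ι]
    (D : TreeDecomposition H ι) {w : ℝ≥0} (hw : ∀ t, f (D.bag t) ≤ w) {S : Set W} (C : Set W)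
    (hS : ∀ x ∈ S, ∀ y ∈ S, x ≠ y → ∃ t, x ∈ D.bag t ∧ y ∈ D.bag t) :
    treeWidth (restrict f (S ∪ C)) (realization H S C) ≤ w := by
  let E : TreeDecomposition (realization H S C) ι :=
    { tree := D.tree
      bag := fun t => Subtype.val ⁻¹' D.bag t
      isTree := D.isTree
      vertex_mem := fun v => D.vertex_mem v
      edge_mem := by
        rintro x y ⟨hxy, h | ⟨hx, hy⟩⟩
        · exact D.edge_mem x y h
        · exact hS x hx y hy fun h => hxy (Subtype.ext h)
      subtree := fun v => D.subtree v }
  exact treeWidth_le_of_forall_bag_le E fun t => (hf (Set.image_preimage_subset _ _)).trans (hw t)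

/-- The set `Ω` and decompositions of the realizations of all blocks associated with `Ω` combine
to a decomposition of `H`: the clique `N(C)` lies in some bag for the block of `C`, and the tree
for that block is attached by an edge from there to the node of `Ω`. -/
theorem treeWidth_le_of_associatedBlocks [Finite W] {f : Set W → ℝ≥0} {Ω : Set W} {w : ℝ≥0} (hΩ : f Ω ≤ w)
    (hw : ∀ S C : Set W, IsAssociatedBlock H Ω S C →
      treeWidth (restrict f (S ∪ C)) (realization H S C) ≤ w) :
    treeWidth f H ≤ w := by
  classical
  -- The decomposition is built one component at a time.
  have key : ∀ K : Finset (H.ComponentCompl Ω), ∃ (ι : Type) (_ : Finite ι) (T : SimpleGraph ι)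
      (bag : ι → Set W) (t₀ : ι), T.IsTree ∧ (∀ v, IsConnectedOn T {t | v ∈ bag t}) ∧
      Ω ⊆ bag t₀ ∧ (∀ t, f (bag t) ≤ w) ∧
      (∀ t, ∀ v ∈ bag t, v ∈ Ω ∨ ∃ D ∈ K, v ∈ D.supp) ∧
      ∀ D ∈ K, ∀ x ∈ D.supp, (∃ t, x ∈ bag t) ∧ ∀ y, H.Adj x y → ∃ t, x ∈ bag t ∧ y ∈ bag t := by
    intro K
    induction K using Finset.induction_on with
    | empty =>
      refine ⟨Unit, inferInstance, ⊥, fun _ => Ω, (), .of_subsingleton, ?_, subset_rfl,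
        fun _ => hΩ, fun _ v hv => .inl hv, by simp⟩
      rintro v Q hQ ⟨q, hq⟩ - t -
      exact Subsingleton.elim q t ▸ hq
    | insert D K hD ih =>
      obtain ⟨ι, hι, T, bag, t₀, hT, hcon, hΩt, hbag, hsub, hcov⟩ := ih
      have hNΩ : nbhd H D.supp ⊆ Ω := by
        rintro y ⟨hy, x, hx, hxy⟩
        by_contra hyΩ
        exact hy (SimpleGraph.ComponentCompl.mem_of_adj x y hx hyΩ hxy)
      obtain ⟨κ, hκ, E, hE⟩ := exists_treeDecomposition (realization H (nbhd H D.supp) D.supp)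
        (restrict f (nbhd H D.supp ∪ D.supp))
      have hEw := fun t => (hE t).trans (hw _ _ ⟨⟨D, rfl⟩, rfl⟩)
      obtain ⟨u₀, hu₀⟩ := E.exists_subset_bag (A := {x | x.1 ∈ nbhd H D.supp})
        fun x hx y hy hxy => E.edge_mem x y ⟨hxy, .inr ⟨hx, hy⟩⟩
      have hmemE : ∀ v u, v ∈ Subtype.val '' E.bag u → v ∈ nbhd H D.supp ∪ D.supp := by
        rintro _ u ⟨v, -, rfl⟩
        exact v.2
      refine ⟨ι ⊕ κ, inferInstance, _, Sum.elim bag fun u => Subtype.val '' E.bag u, Sum.inl t₀,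
        isTree_sum_sup_edge hT E.isTree t₀ u₀, ?_, hΩt, ?_, ?_, ?_⟩
      · intro v
        refine isConnectedOn_sum_sup_edge (hcon v) ?_ ?_
        · by_cases hv : v ∈ nbhd H D.supp ∪ D.supp
          · have heq : {u | v ∈ Subtype.val '' E.bag u} =
                {u | (⟨v, hv⟩ : ↥(nbhd H D.supp ∪ D.supp)) ∈ E.bag u} :=
              Set.ext fun u => ⟨fun ⟨x, hx, hxv⟩ => (Subtype.ext hxv : x = ⟨v, hv⟩) ▸ hx,
                fun h => ⟨_, h, rfl⟩⟩
            rw [heq]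
            exact E.isConnectedOn _
          · intro Q hQ hne
            obtain ⟨q, hq⟩ := hne
            exact absurd (hmemE v q (hQ hq)) hv
        · -- A vertex on both sides belongs to `N(C)`, as the components are disjoint.
          intro t u hvt hvu
          have hvN : v ∈ nbhd H D.supp := by
            refine (hmemE v u hvu).resolve_right fun hvD => ?_
            rcases hsub t v hvt with hvΩ | ⟨D', hD', hvD'⟩
            · exact SimpleGraph.ComponentCompl.notMem_of_mem hvD hvΩ
            · have hne : D ≠ D' := by
                rintro rfl
                exact hD hD'
              exact Set.disjoint_left.1 (SimpleGraph.ComponentCompl.pairwise_disjoint hne) hvD hvD'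
          exact ⟨hΩt (hNΩ hvN), ⟨v, .inl hvN⟩, hu₀ hvN, rfl⟩
      · rintro (t | u)
        · exact hbag t
        · exact hEw u
      · rintro (t | u) v hv
        · exact (hsub t v hv).imp_right fun ⟨D', hD', h⟩ => ⟨D', Finset.mem_insert_of_mem hD', h⟩
        · exact (hmemE v u hv).imp (fun h => hNΩ h) fun h => ⟨D, Finset.mem_insert_self _ _, h⟩
      · intro D' hD' x hx
        rcases Finset.mem_insert.1 hD' with rfl | hD'
        · constructor
          · obtain ⟨u, hu⟩ := E.vertex_mem ⟨x, .inr hx⟩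
            exact ⟨Sum.inr u, _, hu, rfl⟩
          · intro y hxy
            have hy : y ∈ nbhd H D'.supp ∪ D'.supp := by
              by_cases hyD : y ∈ D'.supp
              · exact .inr hyD
              · exact .inl ⟨hyD, x, hx, hxy⟩
            obtain ⟨u, hxu, hyu⟩ := E.edge_mem ⟨x, .inr hx⟩ ⟨y, hy⟩
              ⟨fun h => hxy.ne (congrArg Subtype.val h), .inl hxy⟩
            exact ⟨Sum.inr u, ⟨_, hxu, rfl⟩, ⟨_, hyu, rfl⟩⟩
        · obtain ⟨⟨t, ht⟩, h⟩ := hcov D' hD' x hx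
          refine ⟨⟨Sum.inl t, ht⟩, fun y hxy => ?_⟩
          obtain ⟨t, h1, h2⟩ := h y hxy
          exact ⟨Sum.inl t, h1, h2⟩
  have : Finite (H.ComponentCompl Ω) := inferInstanceAs
    (Finite (H.induce Ωᶜ).ConnectedComponent)
  have := Fintype.ofFinite (H.ComponentCompl Ω)
  obtain ⟨ι, hι, T, bag, t₀, hT, hcon, hΩt, hbag, -, hcov⟩ := key Finset.univ
  have hcov' : ∀ x, x ∉ Ω → (∃ t, x ∈ bag t) ∧ ∀ y, H.Adj x y → ∃ t, x ∈ bag t ∧ y ∈ bag t :=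
    fun x hx => hcov (H.componentComplMk hx) (Finset.mem_univ _) x (H.componentComplMk_mem hx)
  have hvert : ∀ x, ∃ t, x ∈ bag t := fun x =>
    if hx : x ∈ Ω then ⟨t₀, hΩt hx⟩ else (hcov' x hx).1
  let E : TreeDecomposition H ι :=
    { tree := T
      bag := bag
      isTree := hT
      vertex_mem := hvert
      edge_mem := by
        intro x y hxy
        by_cases hx : x ∈ Ω
        · by_cases hy : y ∈ Ω
          · exact ⟨t₀, hΩt hx, hΩt hy⟩
          · obtain ⟨t, h1, h2⟩ := (hcov' y hy).2 x hxy.symm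
            exact ⟨t, h2, h1⟩
        · exact (hcov' x hx).2 y hxy
      subtree := fun v =>
        have : Nonempty {t | v ∈ bag t} := Set.nonempty_coe_sort.2 (hvert v)
        ⟨isConnectedOn_iff_preconnected.1 (hcon v)⟩ }
  exact treeWidth_le_of_forall_bag_le E hbag

end Width

/-! ### Separators and potential maximal cliques -/

section Separators

variable {V : Type*} {G : SimpleGraph V} {S C : Set V}

theorem IsComponentOff.nonempty (hC : IsComponentOff G S C) : C.Nonempty := by
  obtain ⟨D, rfl⟩ := hC
  exact D.nonempty

theorem IsComponentOff.notMem (hC : IsComponentOff G S C) {x : V} (hx : x ∈ C) : x ∉ S := by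
  obtain ⟨D, rfl⟩ := hC
  exact SimpleGraph.ComponentCompl.notMem_of_mem hx

theorem IsComponentOff.mem_of_adj (hC : IsComponentOff G S C) {x y : V} (hx : x ∈ C)
    (hy : y ∉ S) (hxy : G.Adj x y) : y ∈ C := by
  obtain ⟨D, rfl⟩ := hC
  exact SimpleGraph.ComponentCompl.mem_of_adj x y hx hy hxy

theorem IsComponentOff.isConnectedOn (hC : IsComponentOff G S C) : IsConnectedOn G C := by
  obtain ⟨D, rfl⟩ := hC
  rintro Q hQ ⟨q, hq⟩ hcl y hy
  by_contra hyQ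
  obtain ⟨hqS, hqD⟩ := hQ hq
  obtain ⟨hyS, hyD⟩ := hy
  obtain ⟨p⟩ := SimpleGraph.ConnectedComponent.eq.1 (hqD.trans hyD.symm)
  obtain ⟨d, -, h1, h2⟩ := p.exists_boundary_dart (Subtype.val ⁻¹' Q) hq hyQ
  refine h2 (hcl _ h1 _ ?_ d.adj)
  exact SimpleGraph.ComponentCompl.mem_of_adj d.fst.1 d.snd.1 (hQ h1) d.snd.2 d.adj

/-- If `S` is a minimal `u,v`-separator, each `s ∈ S` has a neighbour in the component of `u`:
otherwise `S \ {s}` would separate `u` from `v` as well. -/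
theorem exists_adj_of_minimal_isSeparatorOf {u v : V} (h : Minimal (IsSeparatorOf G u v) S)
    (hu : u ∉ S) {s : V} (hs : s ∈ S) : ∃ c ∈ (G.componentComplMk hu).supp, G.Adj s c := by
  by_contra! hcon
  obtain ⟨huv, _, hv, hne⟩ := h.1
  have hnot : ¬ IsSeparatorOf G u v (S \ {s}) := fun hsep =>
    (h.2 hsep Set.sdiff_subset hs).2 rfl
  have hu' : u ∉ S \ {s} := fun hx => hu hx.1
  have hv' : v ∉ S \ {s} := fun hx => hv hx.1
  have heq : G.componentComplMk hu' = G.componentComplMk hv' := by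
    by_contra hne'
    exact hnot ⟨huv, hu', hv', hne'⟩
  have hcon' : IsConnectedOn G (G.componentComplMk hu').supp :=
    IsComponentOff.isConnectedOn ⟨_, rfl⟩
  have hsub : (G.componentComplMk hu).supp ⊆ (G.componentComplMk hu').supp :=
    (G.componentComplMk hu).subset_hom Set.sdiff_subset
  have hmem : v ∈ (G.componentComplMk hu).supp := by
    refine hcon' (G.componentComplMk hu).supp hsub ⟨u, G.componentComplMk_mem hu⟩ ?_ ⟨hv', heq.symm⟩
    rintro a ha b ⟨hb, -⟩ hab
    by_cases hbS : b ∈ S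
    · obtain rfl : b = s := by
        by_contra hbs
        exact hb ⟨hbS, hbs⟩
      exact absurd hab.symm (hcon a ha)
    · exact SimpleGraph.ComponentCompl.mem_of_adj a b ha hbS hab
  exact hne hmem.choose_spec.symm

/-- Besides `C` there is another component of `G - S` with neighbourhood `S`. -/
theorem IsMinimalSeparator.exists_isComponentOff_ne (hS : IsMinimalSeparator G S) (C : Set V) :
    ∃ C', IsComponentOff G S C' ∧ C' ≠ C ∧ ∀ s ∈ S, ∃ c ∈ C', G.Adj s c := by
  obtain ⟨u, v, h⟩ := hS
  obtain ⟨huv, hu, hv, hne⟩ := h.1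
  have hsymm : ∀ (a b : V) (X : Set V), IsSeparatorOf G a b X → IsSeparatorOf G b a X :=
    fun a b X ⟨hab, ha, hb, hX⟩ => ⟨fun hba => hab hba.symm, hb, ha, hX.symm⟩
  have h' : Minimal (IsSeparatorOf G v u) S :=
    ⟨hsymm _ _ _ h.1, fun X hX hXS => h.2 (hsymm _ _ _ hX) hXS⟩
  by_cases hC : (G.componentComplMk hu).supp = C
  · refine ⟨_, ⟨G.componentComplMk hv, rfl⟩, ?_, fun s hs =>
      exists_adj_of_minimal_isSeparatorOf h' hv hs⟩
    rintro rfl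
    exact hne (SimpleGraph.ComponentCompl.supp_inj.1 hC)
  · exact ⟨_, ⟨G.componentComplMk hu, rfl⟩, hC, fun s hs =>
      exists_adj_of_minimal_isSeparatorOf h hu hs⟩

theorem IsComponentOff.disjoint {C' : Set V} (hC : IsComponentOff G S C)
    (hC' : IsComponentOff G S C') (hne : C' ≠ C) : Disjoint C C' := by
  obtain ⟨D, rfl⟩ := hC
  obtain ⟨D', rfl⟩ := hC'
  exact SimpleGraph.ComponentCompl.pairwise_disjoint fun h => hne (h ▸ rfl)

/-- The chordal graph on `V` obtained from a tree decomposition of `R(S, C)` by making every bag a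
clique and adding the clique on all vertices outside `C`. -/
def bagFill {ι : Type} (D : TreeDecomposition (realization G S C) ι) : SimpleGraph V where
  Adj x y := x ≠ y ∧
    ((∃ t, x ∈ Subtype.val '' D.bag t ∧ y ∈ Subtype.val '' D.bag t) ∨ (x ∉ C ∧ y ∉ C))
  symm := ⟨fun _ _ h => ⟨h.1.symm, h.2.imp (fun ⟨t, hx, hy⟩ => ⟨t, hy, hx⟩) And.symm⟩⟩
  loopless := ⟨fun _ h => h.1 rfl⟩

section BagFill

variable {ι : Type} (D : TreeDecomposition (realization G S C) ι)

theorem exists_bag_of_bagFill_adj {x y : ↥(S ∪ C)} (h : (bagFill D).Adj x.1 y.1) :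
    ∃ t, x ∈ D.bag t ∧ y ∈ D.bag t := by
  obtain ⟨hne, ⟨t, ⟨x', hx, hx'⟩, ⟨y', hy, hy'⟩⟩ | ⟨hx, hy⟩⟩ := h
  · obtain rfl := Subtype.ext hx'
    obtain rfl := Subtype.ext hy'
    exact ⟨t, hx, hy⟩
  · exact D.edge_mem x y ⟨fun h => hne (congrArg Subtype.val h),
      .inr ⟨x.2.resolve_right hx, y.2.resolve_right hy⟩⟩

theorem mem_union_of_bagFill_adj {x y : V} (hx : x ∈ C) (h : (bagFill D).Adj x y) :
    y ∈ S ∪ C := by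
  obtain ⟨-, ⟨t, -, ⟨y', -, rfl⟩⟩ | ⟨hx', -⟩⟩ := h
  · exact y'.2
  · exact absurd hx hx'

theorem isChordal_bagFill [Finite ι] : IsChordal (bagFill D) := by
  refine isChordal_of_exists_simplicial fun A hA => ?_
  by_cases hAS : A ⊆ S ∪ C
  · obtain ⟨x, hx⟩ := hA
    obtain ⟨v, hv, t, h⟩ := D.exists_mem_bag_forall_mem (A := Subtype.val ⁻¹' A)
      ⟨⟨x, hAS hx⟩, hx⟩
    refine ⟨v, hv, fun a ha b hb hva hvb hab => ⟨hab, .inl ⟨t, ?_, ?_⟩⟩⟩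
    · exact ⟨⟨a, hAS ha⟩, h ⟨a, hAS ha⟩ ha
        (exists_bag_of_bagFill_adj D (x := v) (y := ⟨a, hAS ha⟩) hva), rfl⟩
    · exact ⟨⟨b, hAS hb⟩, h ⟨b, hAS hb⟩ hb
        (exists_bag_of_bagFill_adj D (x := v) (y := ⟨b, hAS hb⟩) hvb), rfl⟩
  · obtain ⟨v, hv, hvS⟩ := Set.not_subset.1 hAS
    refine ⟨v, hv, fun a _ b _ hva hvb hab => ⟨hab, .inr ⟨fun ha => ?_, fun hb => ?_⟩⟩⟩
    · exact hvS (mem_union_of_bagFill_adj D ha hva.symm)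
    · exact hvS (mem_union_of_bagFill_adj D hb hvb.symm)

theorem le_bagFill (hC : IsComponentOff G S C) : G ≤ bagFill D := by
  have key : ∀ x y, x ∈ C → G.Adj x y → (bagFill D).Adj x y := by
    intro x y hx hxy
    have hy : y ∈ S ∪ C := by
      by_cases hyS : y ∈ S
      · exact .inl hyS
      · exact .inr (hC.mem_of_adj hx hyS hxy)
    obtain ⟨t, h1, h2⟩ := D.edge_mem ⟨x, .inr hx⟩ ⟨y, hy⟩
      ⟨fun h => hxy.ne (congrArg Subtype.val h), .inl hxy⟩
    exact ⟨hxy.ne, .inl ⟨t, ⟨_, h1, rfl⟩, ⟨_, h2, rfl⟩⟩⟩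
  intro x y hxy
  by_cases hx : x ∈ C
  · exact key x y hx hxy
  · by_cases hy : y ∈ C
    · exact (key y x hy hxy.symm).symm
    · exact ⟨hxy.ne, .inr ⟨hx, hy⟩⟩

end BagFill

/-- A tree decomposition of `R(S, C)` yields a potential maximal clique of `G` that extends `S`
properly inside `S ∪ C` and any two vertices of which share a bag. -/
theorem IsFullBlock.exists_isPotentialMaximalClique [Finite V] (hSC : IsFullBlock G S C)
    {ι : Type} [Finite ι] (D : TreeDecomposition (realization G S C) ι) :
    ∃ Ω : Set V, IsPotentialMaximalClique G Ω ∧ S ⊂ Ω ∧ Ω ⊆ S ∪ C ∧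
      ∀ x y : ↥(S ∪ C), x.1 ∈ Ω → y.1 ∈ Ω → x ≠ y → ∃ t, x ∈ D.bag t ∧ y ∈ D.bag t := by
  obtain ⟨⟨hS, hC⟩, hN⟩ := hSC
  obtain ⟨J, hJle, hJ⟩ := Finite.exists_le_minimal (p := IsTriangulation G)
    (show IsTriangulation G (bagFill D) from ⟨le_bagFill D hC, isChordal_bagFill D⟩)
  have hGJ : G ≤ J := hJ.1.1
  have hchord : IsChordal J := hJ.1.2
  have hadjC : ∀ s ∈ S, ∃ c ∈ C, G.Adj s c := by
    intro s hs
    rw [← hN] at hs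
    obtain ⟨-, c, hc, hcs⟩ := hs
    exact ⟨c, hc, hcs.symm⟩
  -- `S` is a clique of `J`, since no edge of `J` joins `C` to the second full component.
  have hclique : J.IsClique S := by
    obtain ⟨C', hC', hne, hadjC'⟩ := hS.exists_isComponentOff_ne C
    intro a ha b hb hab
    refine hchord.adj_of_isConnectedOn hab (hC.isConnectedOn.mono hGJ)
      (hC'.isConnectedOn.mono hGJ) ?_
      ((hadjC a ha).imp fun c h => ⟨h.1, hGJ h.2⟩) ((hadjC b hb).imp fun c h => ⟨h.1, hGJ h.2⟩)
      ((hadjC' a ha).imp fun c h => ⟨h.1, hGJ h.2⟩) ((hadjC' b hb).imp fun c h => ⟨h.1, hGJ h.2⟩)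
    intro p hp q hq
    have hqC : q ∉ C := fun h => Set.disjoint_left.1 (hC.disjoint hC' hne) h hq
    refine ⟨by rintro rfl; exact hqC hp, fun hpq => ?_⟩
    rcases mem_union_of_bagFill_adj D hp (hJle hpq) with h | h
    · exact hC'.notMem hq h
    · exact hqC h
  obtain ⟨c, hc, hcS⟩ := hchord.exists_adj_forall (hC.isConnectedOn.mono hGJ) hC.nonempty hclique
    (fun s hs h => hC.notMem h hs) fun s hs => (hadjC s hs).imp fun c h => ⟨h.1, hGJ h.2⟩
  obtain ⟨Ω, hle, hΩ⟩ := Finite.exists_le_maximal (p := J.IsClique) (a := insert c S)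
    (hclique.insert fun s hs _ => hcS s hs)
  have hcΩ : c ∈ Ω := hle (Set.mem_insert c S)
  refine ⟨Ω, ⟨J, hJ, hΩ⟩, ⟨fun s hs => hle (.inr hs), fun h => hC.notMem hc (h hcΩ)⟩, ?_, ?_⟩
  · intro x hx
    by_cases hcx : c = x
    · exact .inr (hcx ▸ hc)
    · exact mem_union_of_bagFill_adj D hc (hJle (hΩ.1 hcΩ hx hcx))
  · intro x y hx hy hxy
    exact exists_bag_of_bagFill_adj D (hJle (hΩ.1 hx hy fun h => hxy (Subtype.ext h)))

end Separators

/-! ### The value of a potential maximal clique -/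

section Value

variable {V : Type*} {G : SimpleGraph V} {S C Ω : Set V} {f : Set V → ℝ≥0}

theorem cliqueValue_le {w : ℝ≥0} (hΩ : f Ω ≤ w)
    (hw : ∀ S' C' : Set ↥(S ∪ C),
      IsAssociatedBlock (realization G S C) (Subtype.val ⁻¹' Ω) S' C' →
      treeWidth (restrict (restrict f (S ∪ C)) (S' ∪ C'))
        (realization (realization G S C) S' C') ≤ w) :
    cliqueValue G f S C Ω ≤ w := by
  refine csSup_le ⟨_, .inl rfl⟩ ?_
  rintro _ (rfl | ⟨S', C', h, rfl⟩)
  · exact hΩ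
  · exact hw S' C' h

theorem treeWidth_realization_le_cliqueValue [Finite V] (hf : Monotone f) :
    treeWidth (restrict f (S ∪ C)) (realization G S C) ≤ cliqueValue G f S C Ω := by
  have hbdd : BddAbove ({f Ω} ∪ {w | ∃ S' C' : Set ↥(S ∪ C),
      IsAssociatedBlock (realization G S C) (Subtype.val ⁻¹' Ω) S' C' ∧
      w = treeWidth (restrict (restrict f (S ∪ C)) (S' ∪ C'))
        (realization (realization G S C) S' C')}) := by
    refine Set.Finite.bddAbove ((Set.finite_singleton _).union ?_)
    refine (Set.finite_range fun p : Set ↥(S ∪ C) × Set ↥(S ∪ C) =>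
      treeWidth (restrict (restrict f (S ∪ C)) (p.1 ∪ p.2))
        (realization (realization G S C) p.1 p.2)).subset ?_
    rintro _ ⟨S', C', -, rfl⟩
    exact ⟨(S', C'), rfl⟩
  refine treeWidth_le_of_associatedBlocks (Ω := Subtype.val ⁻¹' Ω) ?_ ?_
  · exact (hf (Set.image_preimage_subset _ _)).trans (le_csSup hbdd (.inl rfl))
  · exact fun S' C' h => le_csSup hbdd (.inr ⟨S', C', h, rfl⟩)

theorem IsFullBlock.exists_cliqueValue_le [Finite V] (hSC : IsFullBlock G S C) (hf : Monotone f) :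
    ∃ Ω : Set V, IsPotentialMaximalClique G Ω ∧ S ⊂ Ω ∧ Ω ⊆ S ∪ C ∧
      cliqueValue G f S C Ω ≤ treeWidth (restrict f (S ∪ C)) (realization G S C) := by
  obtain ⟨ι, hι, D, hD⟩ := exists_treeDecomposition (realization G S C) (restrict f (S ∪ C))
  obtain ⟨Ω, hΩ, hSΩ, hΩsub, hpair⟩ := hSC.exists_isPotentialMaximalClique D
  refine ⟨Ω, hΩ, hSΩ, hΩsub, cliqueValue_le ?_ ?_⟩
  · obtain ⟨t, ht⟩ := D.exists_subset_bag (A := Subtype.val ⁻¹' Ω)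
      fun x hx y hy hxy => hpair x y hx hy hxy
    have hsub : Ω ⊆ Subtype.val '' D.bag t := fun x hx => ⟨⟨x, hΩsub hx⟩, ht hx, rfl⟩
    exact (hf hsub).trans (hD t)
  · rintro S' C' ⟨hC', rfl⟩
    have hN : ∀ x ∈ nbhd (realization G S C) C', x.1 ∈ Ω := by
      rintro x ⟨hx, y, hy, hyx⟩
      by_contra hxΩ
      exact hx (hC'.mem_of_adj hy hxΩ hyx)
    exact treeWidth_realization_le (monotone_restrict hf _) D hD C'
      fun x hx y hy hxy => hpair x y (hN x hx) (hN y hy) hxy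

end Value

end MonotoneWidth

theorem mainTheorem6 {V : Type*} [Finite V] (G : SimpleGraph V) (S C : Set V)
    (hSC : MonotoneWidth.IsFullBlock G S C) (f : Set V → NNReal) (hf : Monotone f) :
    IsLeast
      {w | ∃ Ω : Set V, MonotoneWidth.IsPotentialMaximalClique G Ω ∧ S ⊂ Ω ∧ Ω ⊆ S ∪ C ∧
        w = MonotoneWidth.cliqueValue G f S C Ω}
      (MonotoneWidth.treeWidth (MonotoneWidth.restrict f (S ∪ C))
        (MonotoneWidth.realization G S C)) := by
  constructor
  · obtain ⟨Ω, hΩ, hSΩ, hsub, hle⟩ := hSC.exists_cliqueValue_le hf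
    exact ⟨Ω, hΩ, hSΩ, hsub,
      le_antisymm (MonotoneWidth.treeWidth_realization_le_cliqueValue hf) hle⟩
  · rintro _ ⟨Ω, -, -, -, rfl⟩
    exact MonotoneWidth.treeWidth_realization_le_cliqueValue hf
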